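/- Let $d,K\ge 1$ be integers, let $1<p\le 2$ and $p^*=p/(p-1)$, let $\mathcal X\subseteq\mathbb R^d$ be closed and convex with $\mathcal X\supseteq \mathcal B_p^d=\{x:\|x\|_p\le 1\}$, and let $\varepsilon\in(0,1/2)$ and $\gamma\in(0,1)$. Let $\mathcal F$ be either the class $\mathcal F^0_{\ell_p^d}(1)$ of all convex $f:\mathbb R^d\to\mathbb R$ such that $\|g-h\|_{p^*}\le 1$ for all $x,y\in\mathbb R^d$, $g\in\partial f(x)$, $h\in\partial f(y)$, or the class of all convex $f:\mathbb R^d\to\mathbb R$ that are $\tfrac12$-Lipschitz with respect to $\|\cdot\|_p$ and attain their minimum over $\mathcal X$. Let $\mathcal O$ be any local oracle for $\mathcal F$: it answers a query $x\in\mathcal X$ about $f\in\mathcal F$ by $\mathcal O_f(x)$, and $\mathcal O_f(x)=\mathcal O_g(x)$ whenever $f,g\in\mathcal F$ agree in a neighbourhood of $x$ in $\mathbb R^d$. A $K$-parallel deterministic algorithm $A$ queries in each round a batch of $K$ points of $\mathcal X$, which is a function of the queries and answers of the earlier rounds. Its running time $T(A,f,\varepsilon)$ is the least number of rounds after which some queried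 point $x$ satisfies $f(x)-\inf_{\mathcal X}f\le\varepsilon$ (it is $\infty$ if there is no such number), and $$\mathrm{Compl}^{\gamma}_{\mathrm{HP}}(\mathcal F,\mathcal X,K,\varepsilon)=\sup_{F}\ \inf_{A}\ \inf\{\tau\in\mathbb N:\ \mathbb P_{f\sim F}[T(A,f,\varepsilon)\le\tau]\ge\gamma\},$$ where $F$ runs through the probability distributions on $\mathcal F$. Then the equation $$M=\min\Big\{\frac1{200\varepsilon^2},\ \frac{\varepsilon\, d^{1/p^*}}{32\sqrt{\ln(MK/\gamma)}}\Big\}$$ has exactly one solution $M>0$ (the second term is read as $+\infty$ if $MK\le\gamma$), and $$\mathrm{Compl}^{\gamma}_{\mathrm{HP}}(\mathcal F,\mathcal X,K,\varepsilon)\ \ge\ M .$$ The lower bound $M$ holds, more generally, for every real $M$ that is at most the right-hand side of the equation. In particular, if $d\ge\big(\sqrt{\ln(K/(\varepsilon\gamma))}/\varepsilon^{3}\big)^{p^*}$, then $\mathrm{Compl}^{\gamma}_{\mathrm{HP}}(\mathcal F,\mathcal X,K,\varepsilon)\ge \frac1{200\varepsilon^2}$. -/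

import Mathlib

open scoped ENNReal

/-- `g` is a subgradient of `f` at `x`: a continuous linear functional whose affine minorant
through `(x, f x)` lies below `f` everywhere. -/
def IsSubgradient {E : Type*} [NormedAddCommGroup E] [NormedSpace ℝ E]
    (f : E → ℝ) (x : E) (g : E →L[ℝ] ℝ) : Prop :=
  ∀ y : E, f x + g (y - x) ≤ f y

/-- The nonsmooth class `𝓕⁰(μ)` of a normed space: the convex functions `f : E → ℝ` whose
subgradients vary by at most `μ` in the dual norm (the operator norm of `E →L[ℝ] ℝ`). -/
def nonsmoothClass (E : Type*) [NormedAddCommGroup E] [NormedSpace ℝ E] (μ : ℝ) :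
    Set (E → ℝ) :=
  {f | ConvexOn ℝ Set.univ f ∧
    ∀ (x y : E) (g h : E →L[ℝ] ℝ), IsSubgradient f x g → IsSubgradient f y h → ‖g - h‖ ≤ μ}

/-- The convex functions `f : E → ℝ` that are Lipschitz with constant `L` and attain their minimum
over the feasible set `X`. -/
def lipschitzClass {E : Type*} [NormedAddCommGroup E] [NormedSpace ℝ E] (X : Set E)
    (L : NNReal) : Set (E → ℝ) :=
  {f | ConvexOn ℝ Set.univ f ∧ LipschitzWith L f ∧ ∃ x ∈ X, IsMinOn f X x}

/-- `x` is an `ε`-solution of `min {f y : y ∈ X}`: it is feasible and `f x - inf_X f ≤ ε`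
(there is none if `f` is unbounded below on `X`). -/
def IsEpsSolution {E : Type*} (f : E → ℝ) (X : Set E) (ε : ℝ) (x : E) : Prop :=
  x ∈ X ∧ ∀ y ∈ X, f x - f y ≤ ε

/-- The oracle `O`, which answers the query `x` about the objective `f` by `O f x`, is local for
the class `𝓕` on `X`: two members of the class that agree in a neighbourhood (in the whole space)
of a feasible point get the same answer there. -/
def IsLocalOracle {E A : Type*} [TopologicalSpace E] (𝓕 : Set (E → ℝ)) (X : Set E)
    (O : (E → ℝ) → E → A) : Prop :=
  ∀ f ∈ 𝓕, ∀ g ∈ 𝓕, ∀ x ∈ X, (∀ᶠ y in nhds x, f y = g y) → O f x = O g x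

/-- What is seen in the rounds played so far, in order: each batch of `K` feasible queries with
the batch of its `K` answers. -/
abbrev Transcript {E : Type*} (X : Set E) (A : Type*) (K : ℕ) : Type _ :=
  List ((Fin K → X) × (Fin K → A))

/-- A deterministic `K`-parallel algorithm: it computes the next batch of `K` feasible queries from
all the earlier batches and their answers; the first batch is the one for the empty transcript. -/
abbrev ParallelAlgorithm {E : Type*} (X : Set E) (A : Type*) (K : ℕ) : Type _ :=
  Transcript X A K → Fin K → X

/-- The transcript of the first `t` rounds of `U` on the objective `f`. -/
def transcript {E A : Type*} {X : Set E} {K : ℕ} (O : (E → ℝ) → E → A)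
    (U : ParallelAlgorithm X A K) (f : E → ℝ) : ℕ → Transcript X A K
  | 0 => []
  | t + 1 => transcript O U f t ++
      [(U (transcript O U f t), fun k => O f (U (transcript O U f t) k))]

/-- The running time `T(U, f, ε)`: the least number `t` of rounds such that one of the points
queried in the first `t` rounds is an `ε`-solution (`⊤` if this never happens). The batch of the
round that comes after `s` completed rounds is `U (transcript O U f s)`. -/
noncomputable def runningTime {E A : Type*} {X : Set E} {K : ℕ} (O : (E → ℝ) → E → A)
    (U : ParallelAlgorithm X A K) (f : E → ℝ) (ε : ℝ) : ℕ∞ :=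
  ⨅ (t : ℕ) (_ : ∃ s < t, ∃ k : Fin K, IsEpsSolution f X ε (U (transcript O U f s) k)), (t : ℕ∞)

/-- The high probability `K`-parallel complexity of the class `𝓕` on `X` with the oracle `O`,
`sup_F inf_U inf {τ : ℙ_{f ∼ F}[T(U, f, ε) ≤ τ] ≥ γ}`. Here `F` runs through the probability
measures on `𝓕` (with the σ-algebra generated by the evaluations `f ↦ f x`). The update functions
of `U` need not be measurable; for an event that is not measurable, the probability is the outer
probability, which only makes the complexity smaller. -/
noncomputable def complHP {E A : Type*} (𝓕 : Set (E → ℝ)) (X : Set E) (O : (E → ℝ) → E → A)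
    (K : ℕ) (ε γ : ℝ) : ℕ∞ :=
  ⨆ (F : MeasureTheory.Measure 𝓕) (_ : MeasureTheory.IsProbabilityMeasure F),
    ⨅ (U : ParallelAlgorithm X A K) (τ : ℕ)
      (_ : ENNReal.ofReal γ ≤ F {f : 𝓕 | runningTime O U (f : E → ℝ) ε ≤ (τ : ℕ∞)}), (τ : ℕ∞)

/-- The right-hand side `min {1 / (200 ε²), ε d^{1/p*} / (32 √(ln (M K / γ)))}` of the implicit
definition of `M`, where `p* = p / (p - 1)`. The quotient is taken in `[0, ∞]`, so that the second
term is `∞` when `d > 0` and `M K ≤ γ`. -/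
noncomputable def roundBound (d K : ℕ) (p ε γ M : ℝ) : ℝ≥0∞ :=
  min (ENNReal.ofReal (1 / (200 * ε ^ 2)))
    (ENNReal.ofReal (ε * (d : ℝ) ^ (1 / p.conjExponent)) /
      ENNReal.ofReal (32 * Real.sqrt (Real.log (M * K / γ))))

/-!
The lower bound comes from random objectives whose pieces are revealed one per round. Let
`ℓ i x = d^{-1/p*} ∑ j, ± x j` with independent uniform signs for `i < N`, and take
`f x = 1/2 · max (‖x‖ - 1) (max_i (ℓ i x - (i + 1) η))`. All pieces are `1`-Lipschitz for `‖·‖_p`,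
so `f` is convex and `1/2`-Lipschitz, and the wall `‖x‖ - 1` makes it coercive; hence it belongs to
both function classes (`resisting_mem_class`).

A query that is independent of the signs of `ℓ i` satisfies `|ℓ i x| ≤ t ‖x‖` with high probability:
this is Hoeffding's inequality (`card_lt_abs_sum_signVec_of_update`), since the Euclidean norm is at
most the `ℓ_p` norm for `p ≤ 2`. If all queries of round `s` satisfy this for all `i ≥ s`, then near
them `f` agrees with the maximum over the wall and the pieces up to `ℓ s`
(`eventually_wallMax_eq`): the offsets, with `η = 5 t`, decide where `‖x‖ ≤ 2`, and the wall decides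
elsewhere. Thus, by induction on `s`, a local oracle reveals nothing about `ℓ i` for `i > s` in
round `s`, and the queries of round `s` coincide with those of `resistingTranscript`, which are
functions of `ℓ i`, `i < s`, alone (`transcript_eq_resistingTranscript`). This is what justifies the
independence. The values at the queries of `N` rounds are then at least `-t - N η / 2`, while nearly
orthogonal sign vectors yield a point of norm at most `1/2` with value at most `-3 / (20 √N)`
(`exists_signFunctional_le`). The union bound over queries and pairs of sign vectors gives
`succ_le_complHP_of_union_bound`, and `succ_le_complHP_of_lt` chooses the parameters for each
`N < M`.

The union bound needs `γ / (M K) ≤ 1/2`. Otherwise, for `M > 1`, one has `K = 1`, `M < 2` and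
`γ > 1/2`, and the two objectives `|x₀ ± 1| / 2` suffice (`two_le_complHP`). For `M ≤ 1` the bound
says only that at least one query is needed.
-/

/-! ### The two function classes -/

/-- Each subgradient of a `1/2`-Lipschitz function has norm at most `1/2`, so two of them differ by
at most `1`. -/
theorem mem_nonsmoothClass_of_lipschitzWith {E : Type*} [NormedAddCommGroup E] [NormedSpace ℝ E]
    {f : E → ℝ} (hconv : ConvexOn ℝ Set.univ f) (hlip : LipschitzWith (1 / 2) f) :
    f ∈ nonsmoothClass E 1 := by
  have key : ∀ (x : E) (g : E →L[ℝ] ℝ), IsSubgradient f x g → ‖g‖ ≤ 1 / 2 := by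
    intro x g hg
    have hle : ∀ v : E, g v ≤ 1 / 2 * ‖v‖ := by
      intro v
      have h1 := hg (x + v)
      have h2 := hlip.dist_le_mul (x + v) x
      rw [Real.dist_eq, dist_eq_norm, add_sub_cancel_left] at h2
      rw [add_sub_cancel_left] at h1
      have h3 := le_abs_self (f (x + v) - f x)
      push_cast at h2
      linarith
    refine g.opNorm_le_bound (by norm_num) fun v => ?_
    have h2 := hle (-v)
    rw [map_neg, norm_neg] at h2
    rw [Real.norm_eq_abs]
    exact abs_le.2 ⟨by linarith, hle v⟩
  refine ⟨hconv, fun x y g h hg hh => ?_⟩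
  have := norm_sub_le g h
  have := key x g hg
  have := key y h hh
  linarith

theorem continuous_of_mem_class {E : Type*} [NormedAddCommGroup E] [NormedSpace ℝ E]
    [FiniteDimensional ℝ E] {X : Set E} {𝓕 : Set (E → ℝ)}
    (h𝓕 : 𝓕 = nonsmoothClass E 1 ∨ 𝓕 = lipschitzClass X (1 / 2)) :
    ∀ f ∈ 𝓕, Continuous f := by
  intro f hf
  have hc : ConvexOn ℝ Set.univ f := by
    rcases h𝓕 with rfl | rfl
    exacts [hf.1, hf.1]
  exact continuousOn_univ.1 (hc.continuousOn isOpen_univ)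

theorem mem_class_of_lipschitzWith {E : Type*} [NormedAddCommGroup E] [NormedSpace ℝ E]
    {X : Set E} {𝓕 : Set (E → ℝ)}
    (h𝓕 : 𝓕 = nonsmoothClass E 1 ∨ 𝓕 = lipschitzClass X (1 / 2)) {f : E → ℝ}
    (hconv : ConvexOn ℝ Set.univ f) (hlip : LipschitzWith (1 / 2) f)
    (hmin : ∃ x ∈ X, IsMinOn f X x) : f ∈ 𝓕 := by
  rcases h𝓕 with rfl | rfl
  exacts [mem_nonsmoothClass_of_lipschitzWith hconv hlip, ⟨hconv, hlip, hmin⟩]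

/-! ### Lower bounds for the complexity from finite families -/

/-- Continuous functions on a separable space are determined by their values at the points of a
countable dense set, so the evaluations generate a σ-algebra that contains the singletons. -/
theorem measurableSingletonClass_of_continuous {E : Type*} [TopologicalSpace E]
    [TopologicalSpace.SeparableSpace E] {𝓕 : Set (E → ℝ)} (h𝓕 : ∀ f ∈ 𝓕, Continuous f) :
    MeasurableSingletonClass 𝓕 := by
  obtain ⟨s, hs, hd⟩ := TopologicalSpace.exists_countable_dense E
  refine ⟨fun f => ?_⟩
  have : ({f} : Set 𝓕) = ⋂ x ∈ s, {g : 𝓕 | (g : E → ℝ) x = (f : E → ℝ) x} := by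
    ext g
    simp only [Set.mem_singleton_iff, Set.mem_iInter, Set.mem_ofPred_eq]
    refine ⟨fun h x _ => by rw [h], fun h => Subtype.ext ?_⟩
    exact Continuous.ext_on hd (h𝓕 _ g.2) (h𝓕 _ f.2) h
  rw [this]
  refine MeasurableSet.biInter hs fun x _ => ?_
  exact ((measurable_pi_apply x).comp measurable_subtype_coe) (measurableSet_singleton _)

theorem exists_isEpsSolution_of_runningTime_le {E A : Type*} {X : Set E} {K : ℕ}
    {O : (E → ℝ) → E → A} {U : ParallelAlgorithm X A K} {f : E → ℝ} {ε : ℝ} {N : ℕ}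
    (h : runningTime O U f ε ≤ N) :
    ∃ s < N, ∃ k : Fin K, IsEpsSolution f X ε (U (transcript O U f s) k) := by
  have h1 : runningTime O U f ε < ((N + 1 : ℕ) : ℕ∞) :=
    h.trans_lt (by exact_mod_cast Nat.lt_succ_self N)
  simp only [runningTime, iInf_lt_iff] at h1
  obtain ⟨t, ⟨s, hs, hk⟩, ht⟩ := h1
  have ht' : t < N + 1 := by exact_mod_cast ht
  exact ⟨s, by omega, hk⟩

/-- If, for the uniform distribution on a finite family, each algorithm finds an `ε`-solution within
`N` rounds for a fraction of less than `γ` of the family, then more than `N` rounds are needed. -/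
theorem succ_le_complHP {E A Z : Type*} [TopologicalSpace E]
    [TopologicalSpace.SeparableSpace E] [Fintype Z] [Nonempty Z] {𝓕 : Set (E → ℝ)}
    (h𝓕 : ∀ f ∈ 𝓕, Continuous f) {X : Set E} {O : (E → ℝ) → E → A} {K N : ℕ} {ε γ : ℝ}
    (φ : Z → 𝓕)
    (h : ∀ U : ParallelAlgorithm X A K, ∃ B : Finset Z, (B.card : ℝ) < γ * Fintype.card Z ∧
      ∀ z ∉ B, ∀ s < N, ∀ k : Fin K,
        ¬ IsEpsSolution (φ z : E → ℝ) X ε (U (transcript O U (φ z) s) k)) :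
    ((N + 1 : ℕ) : ℕ∞) ≤ complHP 𝓕 X O K ε γ := by
  classical
  have := measurableSingletonClass_of_continuous h𝓕
  set c : ℝ≥0∞ := (Fintype.card Z : ℝ≥0∞)⁻¹ with hc
  have hZ0 : (Fintype.card Z : ℝ≥0∞) ≠ 0 := by simp
  have hZt : (Fintype.card Z : ℝ≥0∞) ≠ ⊤ := ENNReal.natCast_ne_top _
  set F : MeasureTheory.Measure 𝓕 := c • ∑ z, MeasureTheory.Measure.dirac (φ z) with hF
  have hFapp : ∀ S : Set 𝓕, F S = c * ∑ z, S.indicator 1 (φ z) := by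
    intro S
    simp [hF, MeasureTheory.Measure.finsetSum_apply, MeasureTheory.Measure.dirac_apply]
  have hprob : MeasureTheory.IsProbabilityMeasure F := by
    refine ⟨?_⟩
    rw [hFapp]
    simp [hc, ENNReal.inv_mul_cancel hZ0 hZt]
  refine le_iSup₂_of_le F hprob (le_iInf fun U => le_iInf fun τ => le_iInf fun hτ => ?_)
  by_contra! hlt
  have hτN : τ ≤ N := by
    have : τ < N + 1 := by exact_mod_cast hlt
    omega
  obtain ⟨B, hB, hgood⟩ := h U
  -- The probability of success within `τ ≤ N` rounds is at most the fraction of the family in `B`.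
  have hle : F {f : 𝓕 | runningTime O U (f : E → ℝ) ε ≤ (τ : ℕ∞)} ≤ c * (B.card : ℝ≥0∞) := by
    rw [hFapp]
    gcongr
    rw [← Finset.sum_filter_add_sum_filter_not Finset.univ (· ∈ B)]
    rw [Finset.sum_eq_zero (s := Finset.univ.filter (· ∉ B)), add_zero]
    · refine (Finset.sum_le_card_nsmul _ _ 1 fun z _ => ?_).trans (by simp)
      exact Set.indicator_le_self' (fun _ _ => zero_le) _
    · intro z hz
      refine Set.indicator_of_notMem (fun hmem => ?_) _
      obtain ⟨s, hs, k, hk⟩ := exists_isEpsSolution_of_runningTime_le hmem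
      exact hgood z (Finset.mem_filter.1 hz).2 s (hs.trans_le hτN) k hk
  have hcontra := hτ.trans hle
  rw [hc, mul_comm, ← div_eq_mul_inv, ENNReal.le_div_iff_mul_le (Or.inl hZ0) (Or.inl hZt)] at hcontra
  have hγ : 0 < γ := by
    have h0 : (0 : ℝ) ≤ B.card := by positivity
    have h1 : (0 : ℝ) < Fintype.card Z := by exact_mod_cast Fintype.card_pos
    exact pos_of_mul_pos_left (h0.trans_lt hB) h1.le
  rw [← ENNReal.ofReal_natCast, ← ENNReal.ofReal_natCast, ← ENNReal.ofReal_mul hγ.le,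
    ENNReal.ofReal_le_ofReal_iff (by positivity)] at hcontra
  linarith

/-! ### The resisting objectives -/

/-- The maximum of the wall `‖x‖ - 1` and of the affine functions `ℓ i x - (i + 1) η` for `i < s`. -/
def wallMax {E : Type*} [NormedAddCommGroup E] [NormedSpace ℝ E] (ℓ : ℕ → E →L[ℝ] ℝ) (η : ℝ) :
    ℕ → E → ℝ
  | 0 => fun x => ‖x‖ - 1
  | s + 1 => fun x => max (wallMax ℓ η s x) (ℓ s x - (s + 1) * η)

/-- The objective `1/2 · wallMax`, which is `1/2`-Lipschitz if all `ℓ i` have norm at most `1`. -/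
noncomputable def resisting {E : Type*} [NormedAddCommGroup E] [NormedSpace ℝ E]
    (ℓ : ℕ → E →L[ℝ] ℝ) (η : ℝ) (s : ℕ) (x : E) : ℝ := 1 / 2 * wallMax ℓ η s x

section Resisting

variable {E : Type*} [NormedAddCommGroup E] [NormedSpace ℝ E] {ℓ : ℕ → E →L[ℝ] ℝ} {η : ℝ}

theorem wallMax_congr {ℓ' : ℕ → E →L[ℝ] ℝ} {s : ℕ} (h : ∀ i < s, ℓ i = ℓ' i) :
    wallMax ℓ η s = wallMax ℓ' η s := by
  induction s with
  | zero => rfl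
  | succ s ih => simp only [wallMax, ih fun i hi => h i (by omega), h s (by omega)]

theorem norm_sub_one_le_wallMax (s : ℕ) (x : E) : ‖x‖ - 1 ≤ wallMax ℓ η s x := by
  induction s with
  | zero => exact le_rfl
  | succ s ih => exact ih.trans (le_max_left _ _)

theorem wallMax_le {s : ℕ} {x : E} {c : ℝ} (hx : ‖x‖ - 1 ≤ c)
    (h : ∀ i < s, ℓ i x - (i + 1) * η ≤ c) : wallMax ℓ η s x ≤ c := by
  induction s with
  | zero => exact hx
  | succ s ih => exact max_le (ih fun i hi => h i (by omega)) (h s (by omega))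

theorem convexOn_wallMax (s : ℕ) : ConvexOn ℝ Set.univ (wallMax ℓ η s) := by
  induction s with
  | zero => exact (convexOn_norm convex_univ).add_const (-1)
  | succ s ih =>
    exact ih.sup (((ℓ s).toLinearMap.convexOn convex_univ).add_const (-((s + 1) * η)))

theorem lipschitzWith_wallMax (hℓ : ∀ i, ‖ℓ i‖ ≤ 1) (s : ℕ) :
    LipschitzWith 1 (wallMax ℓ η s) := by
  induction s with
  | zero =>
    have h := (lipschitzWith_one_norm (E := E)).sub (LipschitzWith.const (1 : ℝ))
    rwa [add_zero] at h
  | succ s ih =>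
    have h1 : LipschitzWith 1 (ℓ s) := (ℓ s).lipschitz.weaken (by exact_mod_cast hℓ s)
    have h2 := ih.max (h1.sub (LipschitzWith.const ((s + 1) * η)))
    rwa [add_zero, max_self] at h2

theorem continuous_wallMax (hℓ : ∀ i, ‖ℓ i‖ ≤ 1) (s : ℕ) : Continuous (wallMax ℓ η s) :=
  (lipschitzWith_wallMax hℓ s).continuous

theorem resisting_mem_class [FiniteDimensional ℝ E] {X : Set E} {𝓕 : Set (E → ℝ)}
    (h𝓕 : 𝓕 = nonsmoothClass E 1 ∨ 𝓕 = lipschitzClass X (1 / 2)) (hX : IsClosed X)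
    (hne : X.Nonempty) (hℓ : ∀ i, ‖ℓ i‖ ≤ 1) (s : ℕ) : resisting ℓ η s ∈ 𝓕 := by
  have hlip : LipschitzWith (1 / 2) (resisting ℓ η s) := by
    refine LipschitzWith.of_dist_le_mul fun x y => ?_
    have h := (lipschitzWith_wallMax (η := η) hℓ s).dist_le_mul x y
    rw [Real.dist_eq] at h ⊢
    rw [resisting, resisting, ← mul_sub, abs_mul, abs_of_pos (by norm_num : (0 : ℝ) < 1 / 2)]
    push_cast at h ⊢
    linarith
  refine mem_class_of_lipschitzWith h𝓕 ?_ hlip ?_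
  · exact (convexOn_wallMax s).smul (by norm_num : (0 : ℝ) ≤ 1 / 2)
  · -- The wall makes the objective coercive.
    obtain ⟨x₀, hx₀⟩ := hne
    have : ProperSpace E := FiniteDimensional.proper_real E
    refine hlip.continuous.continuousOn.exists_isMinOn' hX hx₀ ?_
    refine Filter.Eventually.filter_mono inf_le_left ?_
    have hev := (tendsto_norm_cocompact_atTop (E := E)).eventually_ge_atTop
      (2 * resisting ℓ η s x₀ + 1)
    filter_upwards [hev] with x hx
    have := norm_sub_one_le_wallMax (ℓ := ℓ) (η := η) s x
    rw [resisting.eq_def ℓ η s x]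
    linarith

/-- At a point where the functionals `ℓ i` with `i ≥ s` are small compared with the norm, the pieces
after `ℓ s` are not active: where `‖x‖ ≤ 2` they are below the piece of `ℓ s` because of the offsets,
and where `‖x‖ > 2` they are below the wall. -/
theorem eventually_wallMax_eq (hℓ : ∀ i, ‖ℓ i‖ ≤ 1) {t : ℝ} (ht0 : 0 < t) (ht : t ≤ 1 / 2)
    (hη : η = 5 * t) {s N : ℕ} (hsN : s < N) {x : E}
    (hx : ∀ i, s ≤ i → i < N → |ℓ i x| ≤ t * ‖x‖) :
    ∀ᶠ y in nhds x, wallMax ℓ η N y = wallMax ℓ η (s + 1) y := by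
  have hlt : ∀ i, s + 1 ≤ i → i < N → ℓ i x - (i + 1) * η < wallMax ℓ η (s + 1) x := by
    intro i hi hiN
    have hi1 := abs_le.1 (hx i (by omega) hiN)
    have hs1 := abs_le.1 (hx s le_rfl hsN)
    have hcast : (s : ℝ) + 1 ≤ i := by exact_mod_cast hi
    have hi0 : (0 : ℝ) ≤ i := by positivity
    rcases le_or_gt ‖x‖ 2 with h2 | h2
    · refine lt_of_lt_of_le ?_ (le_max_right _ _)
      have : t * ‖x‖ ≤ t * 2 := by gcongr
      subst hη
      nlinarith
    · refine lt_of_lt_of_le ?_ (norm_sub_one_le_wallMax (s + 1) x)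
      have : t * ‖x‖ ≤ 1 / 2 * ‖x‖ := by gcongr
      subst hη
      nlinarith
  have key : ∀ n, s + 1 ≤ n → n ≤ N →
      ∀ᶠ y in nhds x, wallMax ℓ η n y = wallMax ℓ η (s + 1) y := by
    intro n hn
    induction n, hn using Nat.le_induction with
    | base => exact fun _ => Filter.Eventually.of_forall fun _ => rfl
    | succ n hn ih =>
      intro hnN
      have hcont : ∀ᶠ y in nhds x, ℓ n y - (n + 1) * η < wallMax ℓ η (s + 1) y :=
        ((ℓ n).continuous.sub continuous_const).continuousAt.eventually_lt
          (continuous_wallMax hℓ (s + 1)).continuousAt (hlt n hn hnN)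
      filter_upwards [ih (by omega), hcont] with y hy1 hy2
      exact (congrArg (max · _) hy1).trans (max_eq_left hy2.le)
  exact key N hsN le_rfl

/-- Lower bound at a point where the last functional is small compared with the norm. -/
theorem le_wallMax_of_small {t : ℝ} (ht0 : 0 < t) (hη : η = 5 * t) {N : ℕ} (hN : 0 < N) {x : E}
    (hx : |ℓ (N - 1) x| ≤ t * ‖x‖) : -(2 * t) - N * η ≤ wallMax ℓ η N x := by
  obtain ⟨n, rfl⟩ : ∃ n, N = n + 1 := ⟨N - 1, by omega⟩
  rw [Nat.add_sub_cancel] at hx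
  have h1 := abs_le.1 hx
  rcases le_or_gt ‖x‖ 2 with h2 | h2
  · refine le_trans ?_ (le_max_right _ _)
    have : t * ‖x‖ ≤ t * 2 := by gcongr
    push_cast
    linarith
  · refine le_trans ?_ (norm_sub_one_le_wallMax (n + 1) x)
    have : 0 ≤ ((n + 1 : ℕ) : ℝ) * η := by subst hη; positivity
    linarith

/-- The transcript in which the answers of round `s` are those for the objective made from the first
`s + 1` functionals only. The queries of round `s` thus depend on `ℓ i` for `i < s` only. -/
noncomputable def resistingTranscript {A : Type*} {X : Set E} {K : ℕ} (O : (E → ℝ) → E → A)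
    (U : ParallelAlgorithm X A K) (ℓ : ℕ → E →L[ℝ] ℝ) (η : ℝ) : ℕ → Transcript X A K
  | 0 => []
  | s + 1 => resistingTranscript O U ℓ η s ++
      [(U (resistingTranscript O U ℓ η s),
        fun k => O (resisting ℓ η (s + 1)) (U (resistingTranscript O U ℓ η s) k))]

theorem resistingTranscript_congr {A : Type*} {X : Set E} {K : ℕ} {O : (E → ℝ) → E → A}
    {U : ParallelAlgorithm X A K} {ℓ' : ℕ → E →L[ℝ] ℝ} {s : ℕ} (h : ∀ i < s, ℓ i = ℓ' i) :
    resistingTranscript O U ℓ η s = resistingTranscript O U ℓ' η s := by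
  induction s with
  | zero => rfl
  | succ s ih =>
    have h1 : resisting ℓ η (s + 1) = resisting ℓ' η (s + 1) := by
      funext x
      rw [resisting, resisting, wallMax_congr h]
    rw [resistingTranscript, resistingTranscript, ih fun i hi => h i (by omega), h1]

/-- As long as the functionals not yet revealed are small at the queries, a local oracle cannot tell
the objective with all `N` pieces from the truncated ones. -/
theorem transcript_eq_resistingTranscript {A : Type*} {X : Set E} {K : ℕ} {O : (E → ℝ) → E → A}
    {𝓕 : Set (E → ℝ)} (hO : IsLocalOracle 𝓕 X O) {U : ParallelAlgorithm X A K}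
    (hmem : ∀ s, resisting ℓ η s ∈ 𝓕) (hℓ : ∀ i, ‖ℓ i‖ ≤ 1) {t : ℝ} (ht0 : 0 < t)
    (ht : t ≤ 1 / 2) (hη : η = 5 * t) {N : ℕ}
    (hsmall : ∀ s < N, ∀ k : Fin K, ∀ i, s ≤ i → i < N →
      |ℓ i (U (resistingTranscript O U ℓ η s) k)| ≤
        t * ‖(U (resistingTranscript O U ℓ η s) k : E)‖) {s : ℕ} (hs : s ≤ N) :
    transcript O U (resisting ℓ η N) s = resistingTranscript O U ℓ η s := by
  induction s with
  | zero => rfl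
  | succ s ih =>
    rw [transcript, resistingTranscript, ih (by omega)]
    congr 3
    funext k
    refine hO _ (hmem _) _ (hmem _) _ (Subtype.coe_prop _) ?_
    filter_upwards [eventually_wallMax_eq hℓ ht0 ht hη hs (hsmall s hs k)] with y hy
    rw [resisting, resisting, hy]

/-- On the event that the functionals not yet revealed are small at the queries, no query of the
first `N` rounds is an `ε`-solution, provided some feasible point has a value that is small
enough. -/
theorem not_isEpsSolution_of_small {A : Type*} {X : Set E} {K : ℕ} {O : (E → ℝ) → E → A}
    {𝓕 : Set (E → ℝ)} (hO : IsLocalOracle 𝓕 X O) {U : ParallelAlgorithm X A K}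
    (hmem : ∀ s, resisting ℓ η s ∈ 𝓕) (hℓ : ∀ i, ‖ℓ i‖ ≤ 1) {t : ℝ} (ht0 : 0 < t)
    (ht : t ≤ 1 / 2) (hη : η = 5 * t) {N : ℕ}
    (hsmall : ∀ s < N, ∀ k : Fin K, ∀ i, s ≤ i → i < N →
      |ℓ i (U (resistingTranscript O U ℓ η s) k)| ≤
        t * ‖(U (resistingTranscript O U ℓ η s) k : E)‖)
    {ε : ℝ} {y : E} (hyX : y ∈ X) (hy : wallMax ℓ η N y < -(2 * t) - N * η - 2 * ε) {s : ℕ}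
    (hs : s < N) (k : Fin K) :
    ¬ IsEpsSolution (resisting ℓ η N) X ε (U (transcript O U (resisting ℓ η N) s) k) := by
  rw [transcript_eq_resistingTranscript hO hmem hℓ ht0 ht hη hsmall hs.le]
  rintro ⟨-, h⟩
  have h1 := h y hyX
  have h2 := le_wallMax_of_small ht0 hη (by omega) (hsmall s hs k (N - 1) (by omega) (by omega))
  rw [resisting, resisting] at h1
  linarith

end Resisting

/-! ### Random signs -/

/-- The vector of signs `±1` that is encoded by `v`. -/
def signVec {d : ℕ} (v : Fin d → Bool) (j : Fin d) : ℝ := if v j then 1 else -1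

theorem signVec_mul_self {d : ℕ} (v : Fin d → Bool) (j : Fin d) :
    signVec v j * signVec v j = 1 := by
  unfold signVec
  split <;> norm_num

theorem abs_signVec {d : ℕ} (v : Fin d → Bool) (j : Fin d) : |signVec v j| = 1 := by
  unfold signVec
  split <;> norm_num

/-- Random signs are sub-Gaussian. -/
theorem sum_exp_signVec_le {d : ℕ} (x : Fin d → ℝ) :
    ∑ v : Fin d → Bool, Real.exp (∑ j, signVec v j * x j) ≤
      2 ^ d * Real.exp ((∑ j, x j ^ 2) / 2) := by
  calc ∑ v : Fin d → Bool, Real.exp (∑ j, signVec v j * x j)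
      = ∑ v : Fin d → Bool, ∏ j, Real.exp ((if v j then 1 else -1) * x j) := by
        simp only [Real.exp_sum, signVec]
    _ = ∏ j, ∑ b : Bool, Real.exp ((if b then 1 else -1) * x j) :=
        (Fintype.prod_sum fun j b => Real.exp ((if b = true then 1 else -1) * x j)).symm
    _ = ∏ j, 2 * Real.cosh (x j) := by
        refine Finset.prod_congr rfl fun j _ => ?_
        rw [Fintype.sum_bool, Real.cosh_eq]
        simp
        ring
    _ ≤ ∏ j, 2 * Real.exp (x j ^ 2 / 2) := by
        refine Finset.prod_le_prod (fun j _ => ?_) fun j _ => ?_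
        · exact mul_nonneg zero_le_two (Real.cosh_pos _).le
        · exact mul_le_mul_of_nonneg_left (Real.cosh_le_exp_half_sq _) zero_le_two
    _ = 2 ^ d * Real.exp ((∑ j, x j ^ 2) / 2) := by
        rw [Finset.prod_mul_distrib, Finset.prod_const, ← Real.exp_sum, Finset.sum_div]
        simp

/-- Hoeffding's inequality for random signs. -/
theorem card_lt_sum_signVec_le {d : ℕ} (x : Fin d → ℝ) {u : ℝ} (hu : 0 ≤ u) :
    ((Finset.univ.filter fun v : Fin d → Bool =>
      u * √(∑ j, x j ^ 2) < ∑ j, signVec v j * x j).card : ℝ) ≤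
      2 ^ d * Real.exp (-(u ^ 2 / 2)) := by
  set S := ∑ j, x j ^ 2 with hS
  have hS0 : 0 ≤ S := Finset.sum_nonneg fun j _ => sq_nonneg _
  rcases hS0.eq_or_lt with h0 | hpos
  · have hx : ∀ j, x j = 0 := fun j => by
      have := (Finset.sum_eq_zero_iff_of_nonneg fun j _ => sq_nonneg (x j)).1 h0.symm j
        (Finset.mem_univ j)
      exact pow_eq_zero_iff two_ne_zero |>.1 this
    simp only [hx, mul_zero, Finset.sum_const_zero, ← h0, Real.sqrt_zero, lt_irrefl,
      Finset.filter_false, Finset.card_empty, Nat.cast_zero]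
    positivity
  · set σ := √S with hσ
    have hσ0 : 0 < σ := Real.sqrt_pos.2 hpos
    have hσ2 : σ ^ 2 = S := Real.sq_sqrt hS0
    -- The optimal parameter of the exponential Markov inequality is `u / σ`.
    have hmgf := sum_exp_signVec_le fun j => u / σ * x j
    have e1 : (∑ j, (u / σ * x j) ^ 2) / 2 = u ^ 2 / 2 := by
      simp only [mul_pow, ← Finset.mul_sum, ← hS, ← hσ2]
      field_simp
    rw [e1] at hmgf
    have hmarkov : ((Finset.univ.filter fun v : Fin d → Bool =>
        u * σ < ∑ j, signVec v j * x j).card : ℝ) * Real.exp (u ^ 2) ≤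
        ∑ v : Fin d → Bool, Real.exp (∑ j, signVec v j * (u / σ * x j)) := by
      rw [← nsmul_eq_mul]
      refine le_trans (Finset.card_nsmul_le_sum _ _ _ fun v hv => ?_)
        (Finset.sum_le_sum_of_subset_of_nonneg (Finset.filter_subset _ _)
          fun v _ _ => (Real.exp_pos _).le)
      have hv' := (Finset.mem_filter.1 hv).2
      have e2 : ∑ j, signVec v j * (u / σ * x j) = u / σ * ∑ j, signVec v j * x j := by
        rw [Finset.mul_sum]
        exact Finset.sum_congr rfl fun j _ => by ring
      rw [e2, Real.exp_le_exp]
      calc u ^ 2 = u / σ * (u * σ) := by field_simp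
        _ ≤ _ := by gcongr
    have h := hmarkov.trans hmgf
    rw [← le_div_iff₀ (Real.exp_pos _), mul_div_assoc, ← Real.exp_sub] at h
    exact h.trans_eq (by ring_nf)

theorem card_lt_abs_sum_signVec_le {d : ℕ} (x : Fin d → ℝ) {u : ℝ} (hu : 0 ≤ u) :
    ((Finset.univ.filter fun v : Fin d → Bool =>
      u * √(∑ j, x j ^ 2) < |∑ j, signVec v j * x j|).card : ℝ) ≤
      2 * Real.exp (-(u ^ 2 / 2)) * 2 ^ d := by
  have h1 := card_lt_sum_signVec_le x hu
  have h2 := card_lt_sum_signVec_le (fun j => -x j) hu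
  simp only [neg_sq, mul_neg, Finset.sum_neg_distrib] at h2
  have h3 : (Finset.univ.filter fun v : Fin d → Bool =>
      u * √(∑ j, x j ^ 2) < |∑ j, signVec v j * x j|).card ≤
      (Finset.univ.filter fun v : Fin d → Bool =>
        u * √(∑ j, x j ^ 2) < ∑ j, signVec v j * x j).card +
      (Finset.univ.filter fun v : Fin d → Bool =>
        u * √(∑ j, x j ^ 2) < -∑ j, signVec v j * x j).card := by
    simp only [lt_abs, Finset.filter_or]
    exact Finset.card_union_le _ _
  have h4 := (Nat.cast_le (α := ℝ)).2 h3
  push_cast at h4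
  linarith

/-- Resampling one coordinate of a uniformly distributed family does not change its distribution. -/
theorem card_filter_le_of_update {ι V : Type*} [Fintype ι] [DecidableEq ι] [Fintype V]
    (Q : (ι → V) → Prop) [DecidablePred Q] (i : ι) {c : ℝ}
    (h : ∀ z, ((Finset.univ.filter fun v => Q (Function.update z i v)).card : ℝ) ≤
      c * Fintype.card V) :
    ((Finset.univ.filter Q).card : ℝ) ≤ c * Fintype.card (ι → V) := by
  rcases isEmpty_or_nonempty V with hV | hV
  · have : IsEmpty (ι → V) := ⟨fun z => hV.elim (z i)⟩
    simp [Finset.univ_eq_empty]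
  have hV0 : (0 : ℝ) < Fintype.card V := by exact_mod_cast Fintype.card_pos
  -- Exchanging `z i` and `v` is an involution of the pairs `(z, v)`.
  let e : (ι → V) × V → (ι → V) × V := fun w => (Function.update w.1 i w.2, w.1 i)
  have he : Function.Involutive e := fun w => by
    simp only [e, Function.update_self, Function.update_idem, Function.update_eq_self, Prod.mk.eta]
  have h1 : ∑ z : ι → V, ∑ v : V, (if Q (Function.update z i v) then (1 : ℝ) else 0) =
      ∑ z : ι → V, ∑ _v : V, (if Q z then (1 : ℝ) else 0) := by
    rw [← Fintype.sum_prod_type' fun z v => if Q (Function.update z i v) then (1 : ℝ) else 0,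
      ← Fintype.sum_prod_type' fun z _ => if Q z then (1 : ℝ) else 0]
    exact Equiv.sum_comp (he.toPerm e) fun w : (ι → V) × V => if Q w.1 then (1 : ℝ) else 0
  have h2 : ∑ z : ι → V, ∑ v : V, (if Q (Function.update z i v) then (1 : ℝ) else 0) ≤
      ∑ z : ι → V, c * Fintype.card V := by
    refine Finset.sum_le_sum fun z _ => ?_
    rw [Finset.sum_boole]
    exact h z
  rw [h1] at h2
  simp only [Finset.sum_const, Finset.card_univ, nsmul_eq_mul, ← Finset.mul_sum,
    Finset.sum_boole] at h2
  nlinarith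

/-- Hoeffding's inequality for one of several independent sign vectors, against a vector that does
not depend on it. -/
theorem card_lt_abs_sum_signVec_of_update {d N : ℕ} (i : Fin N)
    (x : (Fin N → Fin d → Bool) → Fin d → ℝ) (hx : ∀ z v, x (Function.update z i v) = x z)
    {u : ℝ} (hu : 0 ≤ u) :
    ((Finset.univ.filter fun z : Fin N → Fin d → Bool =>
      u * √(∑ j, x z j ^ 2) < |∑ j, signVec (z i) j * x z j|).card : ℝ) ≤
      2 * Real.exp (-(u ^ 2 / 2)) * Fintype.card (Fin N → Fin d → Bool) := by
  refine card_filter_le_of_update _ i fun z => ?_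
  simp only [hx, Function.update_self]
  refine (card_lt_abs_sum_signVec_le (x z) hu).trans_eq ?_
  simp

/-! ### Norms on `ℓ_p^d` -/

section Norms

variable {d : ℕ} {p : ℝ≥0∞}

theorem norm_rpow_eq_sum (hp : 0 < p.toReal) (x : PiLp p (fun _ : Fin d => ℝ)) :
    ‖x‖ ^ p.toReal = ∑ j, |x j| ^ p.toReal := by
  have h0 : 0 ≤ ∑ j, |x j| ^ p.toReal := Finset.sum_nonneg fun j _ => by positivity
  rw [PiLp.norm_eq_sum hp]
  simp only [Real.norm_eq_abs]
  rw [← Real.rpow_mul h0, one_div_mul_cancel hp.ne', Real.rpow_one]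

variable [Fact (1 ≤ p)]

/-- For `p ≤ 2`, the Euclidean norm is at most the `ℓ_p` norm. -/
theorem sqrt_sum_sq_le_norm (hp : 0 < p.toReal) (hp2 : p.toReal ≤ 2)
    (x : PiLp p (fun _ : Fin d => ℝ)) : √(∑ j, x j ^ 2) ≤ ‖x‖ := by
  refine Real.sqrt_le_iff.2 ⟨norm_nonneg _, ?_⟩
  have hsplit : ∀ r : ℝ, 0 ≤ r → r ^ 2 = r ^ p.toReal * r ^ (2 - p.toReal) := fun r hr => by
    rw [← Real.rpow_add_of_nonneg hr hp.le (by linarith)]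
    norm_num
  calc ∑ j, x j ^ 2 = ∑ j, |x j| ^ p.toReal * |x j| ^ (2 - p.toReal) :=
        Finset.sum_congr rfl fun j _ => by rw [← sq_abs, hsplit _ (abs_nonneg _)]
    _ ≤ ∑ j, |x j| ^ p.toReal * ‖x‖ ^ (2 - p.toReal) := by
        refine Finset.sum_le_sum fun j _ => ?_
        have : |x j| ≤ ‖x‖ := PiLp.norm_apply_le x j
        have h2 : 0 ≤ 2 - p.toReal := by linarith
        gcongr
    _ = ‖x‖ ^ 2 := by
        rw [← Finset.sum_mul, ← norm_rpow_eq_sum hp, ← hsplit _ (norm_nonneg _)]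

theorem sum_abs_le_norm (hd : 0 < d) (hp : 1 ≤ p.toReal) (x : PiLp p (fun _ : Fin d => ℝ)) :
    ∑ j, |x j| ≤ (d : ℝ) ^ (1 - 1 / p.toReal) * ‖x‖ := by
  have hp0 : 0 < p.toReal := by linarith
  have hd0 : (0 : ℝ) < d := by exact_mod_cast hd
  have h := Real.rpow_sum_le_const_mul_sum_rpow Finset.univ (fun j => x j) hp
  rw [← norm_rpow_eq_sum hp0, Finset.card_univ, Fintype.card_fin] at h
  have hS : 0 ≤ ∑ j, |x j| := Finset.sum_nonneg fun j _ => abs_nonneg _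
  rw [← Real.rpow_le_rpow_iff hS (by positivity) hp0, Real.mul_rpow (by positivity) (norm_nonneg _),
    ← Real.rpow_mul hd0.le]
  convert h using 3
  field_simp

theorem norm_sq_le_sum_sq (hp : 0 < p.toReal) (hp2 : p.toReal ≤ 2)
    (x : PiLp p (fun _ : Fin d => ℝ)) :
    ‖x‖ ^ 2 ≤ (d : ℝ) ^ (2 / p.toReal - 1) * ∑ j, x j ^ 2 := by
  have h := Real.rpow_sum_le_const_mul_sum_rpow Finset.univ (fun j => |x j| ^ p.toReal)
    (p := 2 / p.toReal) (by rw [le_div_iff₀ hp]; linarith)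
  have e : ∀ j, |(|x j| ^ p.toReal)| ^ (2 / p.toReal) = x j ^ 2 := fun j => by
    rw [abs_of_nonneg (by positivity), ← Real.rpow_mul (abs_nonneg _),
      mul_div_cancel₀ _ hp.ne', Real.rpow_two, sq_abs]
  simp only [e] at h
  have e2 : ∑ j, |(|x j| ^ p.toReal)| = ‖x‖ ^ p.toReal := by
    rw [norm_rpow_eq_sum hp]
    exact Finset.sum_congr rfl fun j _ => abs_of_nonneg (by positivity)
  rwa [e2, ← Real.rpow_mul (norm_nonneg _), mul_div_cancel₀ _ hp.ne', Real.rpow_two,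
    Finset.card_univ, Fintype.card_fin] at h

/-- The functional `x ↦ d^{-1/p*} ∑ j, ± x j` with the signs of `v`, where `1 / p* = 1 - 1 / p`. -/
noncomputable def signFunctional (p : ℝ≥0∞) [Fact (1 ≤ p)] (v : Fin d → Bool) :
    PiLp p (fun _ : Fin d => ℝ) →L[ℝ] ℝ :=
  ((d : ℝ) ^ (1 - 1 / p.toReal))⁻¹ • ∑ j, signVec v j • PiLp.proj p (fun _ : Fin d => ℝ) j

theorem signFunctional_apply (v : Fin d → Bool) (x : PiLp p (fun _ : Fin d => ℝ)) :
    signFunctional p v x = ((d : ℝ) ^ (1 - 1 / p.toReal))⁻¹ * ∑ j, signVec v j * x j := by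
  simp [signFunctional, PiLp.proj_apply]

theorem norm_signFunctional_le (hd : 0 < d) (hp : 1 ≤ p.toReal) (v : Fin d → Bool) :
    ‖signFunctional p v‖ ≤ 1 := by
  have hd0 : (0 : ℝ) < d := by exact_mod_cast hd
  refine ContinuousLinearMap.opNorm_le_bound _ zero_le_one fun x => ?_
  have h1 : |∑ j, signVec v j * x j| ≤ ∑ j, |x j| := by
    refine (Finset.abs_sum_le_sum_abs _ _).trans_eq (Finset.sum_congr rfl fun j _ => ?_)
    rw [abs_mul, abs_signVec, one_mul]
  have hpos : 0 < (d : ℝ) ^ (1 - 1 / p.toReal) := by positivity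
  rw [signFunctional_apply, Real.norm_eq_abs, abs_mul, abs_of_pos (inv_pos.2 hpos), one_mul,
    inv_mul_le_iff₀ hpos]
  exact h1.trans (sum_abs_le_norm hd hp x)

/-- If the sign vectors are nearly orthogonal, then a negative multiple of their sum is a point of
norm at most `1/2` at which all the functionals are at most `-3 / (10 √N)`. -/
theorem exists_signFunctional_le (hd : 0 < d) (hp : 1 ≤ p.toReal) (hp2 : p.toReal ≤ 2) {N : ℕ}
    (hN : 0 < N) (z : Fin N → Fin d → Bool)
    (hz : ∀ i i', i ≠ i' → |∑ j, signVec (z i) j * signVec (z i') j| ≤ d / (4 * N)) :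
    ∃ y : PiLp p (fun _ : Fin d => ℝ), ‖y‖ ≤ 1 / 2 ∧
      ∀ i, signFunctional p (z i) y ≤ -(3 / (10 * √N)) := by
  have hd0 : (0 : ℝ) < d := by exact_mod_cast hd
  have hN0 : (0 : ℝ) < N := by exact_mod_cast hN
  have hp0 : 0 < p.toReal := by linarith
  set w : PiLp p (fun _ : Fin d => ℝ) := WithLp.toLp p fun j => ∑ i, signVec (z i) j with hw
  have hinner : ∀ i, |∑ j, signVec (z i) j * w j - d| ≤ d / 4 := by
    intro i
    have e1 : ∑ j, signVec (z i) j * w j = ∑ i', ∑ j, signVec (z i) j * signVec (z i') j := by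
      rw [Finset.sum_comm]
      exact Finset.sum_congr rfl fun j _ => by rw [hw, Finset.mul_sum]
    have e2 : ∑ j, signVec (z i) j * w j - d =
        ∑ i' ∈ Finset.univ.erase i, ∑ j, signVec (z i) j * signVec (z i') j := by
      rw [e1, ← Finset.add_sum_erase _ _ (Finset.mem_univ i)]
      simp [signVec_mul_self]
    rw [e2]
    calc _ ≤ ∑ i' ∈ Finset.univ.erase i, |∑ j, signVec (z i) j * signVec (z i') j| :=
          Finset.abs_sum_le_sum_abs _ _
      _ ≤ ∑ i' ∈ Finset.univ.erase i, (d : ℝ) / (4 * N) :=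
          Finset.sum_le_sum fun i' hi' => hz i i' (Finset.ne_of_mem_erase hi').symm
      _ ≤ ∑ i' : Fin N, (d : ℝ) / (4 * N) :=
          Finset.sum_le_sum_of_subset_of_nonneg (Finset.subset_univ _) fun _ _ _ => by positivity
      _ = d / 4 := by
          simp only [Finset.sum_const, Finset.card_univ, Fintype.card_fin, nsmul_eq_mul]
          field_simp
  have hsq : ∑ j, w j ^ 2 ≤ N * (5 / 4 * d) := by
    have e : ∑ j, w j ^ 2 = ∑ i, ∑ j, signVec (z i) j * w j := by
      rw [Finset.sum_comm]
      refine Finset.sum_congr rfl fun j _ => ?_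
      rw [← Finset.sum_mul, sq]
    rw [e]
    calc _ ≤ ∑ _i : Fin N, (5 / 4 * d : ℝ) :=
          Finset.sum_le_sum fun i _ => by linarith [(abs_le.1 (hinner i)).2]
      _ = _ := by simp
  have hD : (d : ℝ) ^ (2 / p.toReal - 1) * d = ((d : ℝ) ^ (1 / p.toReal)) ^ 2 := by
    rw [← Real.rpow_add_one hd0.ne', ← Real.rpow_natCast, ← Real.rpow_mul hd0.le]
    congr 1
    push_cast
    ring
  have hnorm : ‖w‖ ≤ 5 / 4 * ((d : ℝ) ^ (1 / p.toReal) * √N) := by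
    refine le_of_sq_le_sq ?_ (by positivity)
    have h1 := norm_sq_le_sum_sq hp0 hp2 w
    have h2 : (d : ℝ) ^ (2 / p.toReal - 1) * ∑ j, w j ^ 2 ≤
        (d : ℝ) ^ (2 / p.toReal - 1) * (N * (5 / 4 * d)) := by gcongr
    have h3 : (d : ℝ) ^ (2 / p.toReal - 1) * (N * (5 / 4 * d)) =
        5 / 4 * (((d : ℝ) ^ (1 / p.toReal)) ^ 2 * N) := by rw [← hD]; ring
    rw [mul_pow, mul_pow, Real.sq_sqrt hN0.le]
    have h4 : 0 ≤ ((d : ℝ) ^ (1 / p.toReal)) ^ 2 * N := by positivity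
    linarith
  set D := (d : ℝ) ^ (1 / p.toReal) with hDdef
  have hDpos : 0 < D := by positivity
  have hs : 0 < √(N : ℝ) := Real.sqrt_pos.2 hN0
  refine ⟨-(2 / (5 * (D * √N))) • w, ?_, fun i => ?_⟩
  · rw [norm_smul, norm_neg, Real.norm_eq_abs, abs_of_pos (by positivity)]
    calc _ ≤ 2 / (5 * (D * √N)) * (5 / 4 * (D * √N)) := by gcongr
      _ = 1 / 2 := by field_simp; norm_num
  · have hdd : (d : ℝ) ^ (1 - 1 / p.toReal) = d / D := by
      rw [Real.rpow_sub hd0, Real.rpow_one]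
    rw [map_smul, signFunctional_apply, hdd, smul_eq_mul]
    have h1 := (abs_le.1 (hinner i)).1
    have h2 : 3 / 4 * (d : ℝ) ≤ ∑ j, signVec (z i) j * w j := by linarith
    have h3 : 2 / (5 * (D * √N)) * ((d / D)⁻¹ * (3 / 4 * d)) = 3 / (10 * √(N : ℝ)) := by
      field_simp
      norm_num
    rw [neg_mul, neg_le_neg_iff, ← h3]
    gcongr

end Norms

/-! ### Lower bounds for the complexity on `ℓ_p^d` -/

/-- The union bound. -/
theorem card_filter_exists_le {α Z : Type*} [Fintype α] [Fintype Z] (Q : α → Z → Prop)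
    [∀ a, DecidablePred (Q a)] [DecidablePred fun z => ∃ a, Q a z] {c : ℝ}
    (h : ∀ a, ((Finset.univ.filter (Q a)).card : ℝ) ≤ c) :
    ((Finset.univ.filter fun z => ∃ a, Q a z).card : ℝ) ≤ Fintype.card α * c := by
  classical
  have e : (Finset.univ.filter fun z => ∃ a, Q a z) =
      Finset.univ.biUnion fun a => Finset.univ.filter (Q a) := by
    ext z
    simp
  rw [e]
  calc _ ≤ ((∑ a, (Finset.univ.filter (Q a)).card : ℕ) : ℝ) := by
        exact_mod_cast Finset.card_biUnion_le
    _ = ∑ a, ((Finset.univ.filter (Q a)).card : ℝ) := Nat.cast_sum _ _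
    _ ≤ ∑ _a : α, c := Finset.sum_le_sum fun a _ => h a
    _ = _ := by simp

/-- The sequence of sign functionals of a finite family of sign vectors, continued by `0`. -/
noncomputable def signSequence (p : ℝ≥0∞) [Fact (1 ≤ p)] {d N : ℕ} (z : Fin N → Fin d → Bool)
    (i : ℕ) : PiLp p (fun _ : Fin d => ℝ) →L[ℝ] ℝ :=
  if h : i < N then signFunctional p (z ⟨i, h⟩) else 0

theorem signSequence_of_lt {p : ℝ≥0∞} [Fact (1 ≤ p)] {d N : ℕ} (z : Fin N → Fin d → Bool)
    {i : ℕ} (h : i < N) : signSequence p z i = signFunctional p (z ⟨i, h⟩) := dif_pos h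

theorem signSequence_update {p : ℝ≥0∞} [Fact (1 ≤ p)] {d N : ℕ} (z : Fin N → Fin d → Bool)
    {i : Fin N} (v : Fin d → Bool) {i' : ℕ} (h : i' < i) :
    signSequence p (Function.update z i v) i' = signSequence p z i' := by
  have h' : i' < N := h.trans i.2
  rw [signSequence_of_lt _ h', signSequence_of_lt _ h',
    Function.update_of_ne (Fin.ne_of_lt h)]

section Complexity

variable {d K : ℕ} {p : ℝ≥0∞} [Fact (1 ≤ p)] {X : Set (PiLp p (fun _ : Fin d => ℝ))}
  {𝓕 : Set (PiLp p (fun _ : Fin d => ℝ) → ℝ)} {A : Type*}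
  {O : (PiLp p (fun _ : Fin d => ℝ) → ℝ) → PiLp p (fun _ : Fin d => ℝ) → A} {ε γ : ℝ}

/-- The complexity exceeds `N` if the deviation `u` of a sum of random signs, in multiples of the
standard deviation, is so large that the union bound over all queries and all pairs of sign vectors
applies, and is small enough to keep the objective away from its minimum. -/
theorem succ_le_complHP_of_union_bound (hd : 0 < d) (hK : 0 < K) (hp : 1 ≤ p.toReal)
    (hp2 : p.toReal ≤ 2) (hXclosed : IsClosed X) (hX : Metric.closedBall 0 1 ⊆ X)
    (h𝓕 : 𝓕 = nonsmoothClass _ 1 ∨ 𝓕 = lipschitzClass X (1 / 2)) (hO : IsLocalOracle 𝓕 X O)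
    {N : ℕ} (hN : 0 < N) {t u : ℝ} (hu : 0 ≤ u) (ht0 : 0 < t) (ht : t ≤ 1 / 2)
    (hut : u ≤ t * (d : ℝ) ^ (1 - 1 / p.toReal)) (hpair : u * √d ≤ d / (4 * N))
    (hunion : 4 * (N : ℝ) ^ 2 * K * Real.exp (-(u ^ 2 / 2)) < γ)
    (hval : 2 * t + N * (5 * t) + 2 * ε < 3 / (10 * √N)) :
    ((N + 1 : ℕ) : ℕ∞) ≤ complHP 𝓕 X O K ε γ := by
  classical
  have hd0 : (0 : ℝ) < d := by exact_mod_cast hd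
  have hN0 : (0 : ℝ) < N := by exact_mod_cast hN
  have hp0 : 0 < p.toReal := by linarith
  have hℓ : ∀ (z : Fin N → Fin d → Bool) i, ‖signSequence p z i‖ ≤ 1 := by
    intro z i
    unfold signSequence
    split
    · exact norm_signFunctional_le hd hp _
    · simp
  have hne : X.Nonempty := ⟨0, hX (by simp)⟩
  have hmem : ∀ (z : Fin N → Fin d → Bool) s, resisting (signSequence p z) (5 * t) s ∈ 𝓕 :=
    fun z s => resisting_mem_class h𝓕 hXclosed hne (hℓ z) s
  refine succ_le_complHP (continuous_of_mem_class h𝓕) (fun z => ⟨_, hmem z N⟩) fun U => ?_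
  set q : (Fin N → Fin d → Bool) → ℕ → Fin K → PiLp p (fun _ : Fin d => ℝ) :=
    fun z s k => (U (resistingTranscript O U (signSequence p z) (5 * t) s) k : _) with hq
  set c := 2 * Real.exp (-(u ^ 2 / 2)) * Fintype.card (Fin N → Fin d → Bool) with hc
  have hc0 : 0 ≤ c := by positivity
  let Q₁ : Fin N × Fin K × Fin N → (Fin N → Fin d → Bool) → Prop := fun a z =>
    a.1 ≤ a.2.2 ∧ u * √(∑ j, (q z a.1 a.2.1 j) ^ 2) <
      |∑ j, signVec (z a.2.2) j * q z a.1 a.2.1 j|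
  let Q₂ : Fin N × Fin N → (Fin N → Fin d → Bool) → Prop := fun a z =>
    a.1 ≠ a.2 ∧ u * √(∑ j, signVec (z a.2) j ^ 2) < |∑ j, signVec (z a.1) j * signVec (z a.2) j|
  have hQ₁ : ∀ a, ((Finset.univ.filter (Q₁ a)).card : ℝ) ≤ c := by
    rintro ⟨s, k, i⟩
    by_cases hsi : s ≤ i
    · simp only [Q₁, hsi, true_and]
      refine card_lt_abs_sum_signVec_of_update i (fun z => (q z s k).ofLp) (fun z v => ?_) hu
      -- The queries of round `s` are determined by the first `s` sign vectors.
      simp only [hq]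
      rw [resistingTranscript_congr fun i' hi' => signSequence_update z v
        (lt_of_lt_of_le hi' (Fin.le_def.1 hsi))]
    · simpa [Q₁, hsi] using hc0
  have hQ₂ : ∀ a, ((Finset.univ.filter (Q₂ a)).card : ℝ) ≤ c := by
    rintro ⟨i, i'⟩
    by_cases hii : i = i'
    · simpa [Q₂, hii] using hc0
    · simp only [Q₂, ne_eq, hii, not_false_eq_true, true_and]
      refine card_lt_abs_sum_signVec_of_update i (fun z => signVec (z i')) (fun z v => ?_) hu
      rw [Function.update_of_ne (Ne.symm hii)]
  refine ⟨(Finset.univ.filter fun z => ∃ a, Q₁ a z) ∪ (Finset.univ.filter fun z => ∃ a, Q₂ a z),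
    ?_, fun z hz s hs k => ?_⟩
  · have h1 := card_filter_exists_le Q₁ hQ₁
    have h2 := card_filter_exists_le Q₂ hQ₂
    have h3 : ((_ ∪ _ : Finset _).card : ℝ) ≤ _ := Nat.cast_le.2 (Finset.card_union_le
      (Finset.univ.filter fun z => ∃ a, Q₁ a z) (Finset.univ.filter fun z => ∃ a, Q₂ a z))
    simp only [Fintype.card_prod, Fintype.card_fin] at h1 h2
    push_cast at h1 h2 h3
    have hK1 : (1 : ℝ) ≤ K := by exact_mod_cast hK
    have hcard : (0 : ℝ) < Fintype.card (Fin N → Fin d → Bool) := by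
      exact_mod_cast Fintype.card_pos
    calc _ ≤ (N : ℝ) * (K * N) * c + N * N * c := h3.trans (add_le_add h1 h2)
      _ ≤ (N : ℝ) * (K * N) * c + N * (K * N) * c := by
          have : (N : ℝ) * N * c ≤ N * (K * N) * c := by
            gcongr
            exact le_mul_of_one_le_left hN0.le hK1
          linarith
      _ = 4 * (N : ℝ) ^ 2 * K * Real.exp (-(u ^ 2 / 2)) *
            Fintype.card (Fin N → Fin d → Bool) := by rw [hc]; ring
      _ < _ := by gcongr
  · simp only [Finset.mem_union, Finset.mem_filter, Finset.mem_univ, true_and, not_or,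
      not_exists] at hz
    obtain ⟨hz1, hz2⟩ := hz
    have hpos : 0 < (d : ℝ) ^ (1 - 1 / p.toReal) := by positivity
    have hsmall : ∀ s < N, ∀ k : Fin K, ∀ i, s ≤ i → i < N →
        |signSequence p z i (q z s k)| ≤ t * ‖q z s k‖ := by
      intro s hs k i hsi hi
      have h1 : |∑ j, signVec (z ⟨i, hi⟩) j * q z s k j| ≤ u * √(∑ j, (q z s k j) ^ 2) := by
        by_contra! hcon
        exact hz1 (⟨s, hs⟩, k, ⟨i, hi⟩) ⟨hsi, hcon⟩
      rw [signSequence_of_lt z hi, signFunctional_apply, abs_mul, abs_of_pos (inv_pos.2 hpos),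
        inv_mul_le_iff₀ hpos]
      calc _ ≤ u * √(∑ j, (q z s k j) ^ 2) := h1
        _ ≤ t * (d : ℝ) ^ (1 - 1 / p.toReal) * ‖q z s k‖ := by
            gcongr
            exact sqrt_sum_sq_le_norm hp0 hp2 _
        _ = _ := by ring
    obtain ⟨y, hy, hzy⟩ := exists_signFunctional_le (p := p) hd hp hp2 hN z fun i i' hii => by
      have h1 : |∑ j, signVec (z i) j * signVec (z i') j| ≤
          u * √(∑ j, signVec (z i') j ^ 2) := by
        by_contra! hcon
        exact hz2 (i, i') ⟨hii, hcon⟩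
      have h2 : ∑ j, signVec (z i') j ^ 2 = d := by simp [sq, signVec_mul_self]
      rw [h2] at h1
      exact h1.trans hpair
    refine not_isEpsSolution_of_small hO (hmem z) (hℓ z) ht0 ht rfl hsmall (y := y)
      (hX (by simpa using hy.trans (by norm_num))) ?_ hs k
    have hsqrt : 1 ≤ √(N : ℝ) := Real.one_le_sqrt.2 (by exact_mod_cast hN)
    have hle : wallMax (signSequence p z) (5 * t) N y ≤ -(3 / (10 * √N)) := by
      refine wallMax_le ?_ fun i hi => ?_
      · have : 3 / (10 * √(N : ℝ)) ≤ 1 / 2 := by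
          rw [div_le_div_iff₀ (by positivity) (by norm_num)]
          linarith
        linarith
      · rw [signSequence_of_lt z hi]
        have h1 := hzy ⟨i, hi⟩
        have h2 : 0 ≤ ((i : ℝ) + 1) * (5 * t) := by positivity
        linarith
    linarith

/-- Some query is always needed. -/
theorem one_le_complHP (hXclosed : IsClosed X)
    (hX : Metric.closedBall 0 1 ⊆ X)
    (h𝓕 : 𝓕 = nonsmoothClass _ 1 ∨ 𝓕 = lipschitzClass X (1 / 2)) (hγ : 0 < γ) :
    1 ≤ complHP 𝓕 X O K ε γ := by
  have hmem : resisting (fun _ => 0) 0 0 ∈ 𝓕 :=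
    resisting_mem_class h𝓕 hXclosed ⟨0, hX (by simp)⟩ (by simp) 0
  have h := succ_le_complHP (Z := Unit) (N := 0) (X := X) (O := O) (K := K) (ε := ε) (γ := γ)
    (continuous_of_mem_class h𝓕) (fun _ => ⟨_, hmem⟩) fun U => ⟨∅, by simpa using hγ, by simp⟩
  simpa using h

/-- With one query per round, two rounds are needed for a success probability above `1/2`: the first
query cannot be an `ε`-solution for both `|x₀ - 1| / 2` and `|x₀ + 1| / 2`. -/
theorem two_le_complHP (hd : 0 < d) (hX : Metric.closedBall 0 1 ⊆ X)
    (h𝓕 : 𝓕 = nonsmoothClass _ 1 ∨ 𝓕 = lipschitzClass X (1 / 2)) (hε : ε < 1 / 2)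
    (hγ : 1 / 2 < γ) : 2 ≤ complHP 𝓕 X O 1 ε γ := by
  classical
  set j₀ : Fin d := ⟨0, hd⟩
  let σ : Bool → ℝ := fun b => if b then 1 else -1
  let f : Bool → PiLp p (fun _ : Fin d => ℝ) → ℝ := fun b x => 1 / 2 * |x j₀ - σ b|
  let e : Bool → PiLp p (fun _ : Fin d => ℝ) := fun b => PiLp.single p j₀ (σ b)
  have heX : ∀ b, e b ∈ X := fun b => hX <| by
    rw [mem_closedBall_zero_iff, PiLp.norm_single]
    cases b <;> simp [σ]
  have hfe : ∀ b, f b (e b) = 0 := fun b => by simp [f, e]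
  have hf0 : ∀ b x, 0 ≤ f b x := fun b x => by positivity
  have hmem : ∀ b, f b ∈ 𝓕 := by
    intro b
    refine mem_class_of_lipschitzWith h𝓕 ⟨convex_univ, fun x _ y _ r s hr hs hrs => ?_⟩ ?_
      ⟨e b, heX b, fun x _ => by simpa [hfe] using hf0 b x⟩
    · have h1 : (r • x + s • y) j₀ - σ b = r * (x j₀ - σ b) + s * (y j₀ - σ b) := by
        simp only [PiLp.add_apply, PiLp.smul_apply, smul_eq_mul]
        linear_combination σ b * hrs
      have h2 := abs_add_le (r * (x j₀ - σ b)) (s * (y j₀ - σ b))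
      rw [abs_mul, abs_mul, abs_of_nonneg hr, abs_of_nonneg hs] at h2
      simp only [f, h1, smul_eq_mul]
      linarith
    · refine LipschitzWith.of_dist_le_mul fun x y => ?_
      have h1 := abs_abs_sub_abs_le_abs_sub (x j₀ - σ b) (y j₀ - σ b)
      have h2 : |x j₀ - y j₀| ≤ dist x y := by
        rw [dist_eq_norm]
        exact PiLp.norm_apply_le (x - y) j₀
      rw [sub_sub_sub_cancel_right] at h1
      simp only [f]
      rw [Real.dist_eq, ← mul_sub, abs_mul, abs_of_pos (by norm_num : (0 : ℝ) < 1 / 2)]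
      push_cast
      linarith
  refine succ_le_complHP (Z := Bool) (N := 1) (continuous_of_mem_class h𝓕)
    (fun b => ⟨f b, hmem b⟩) fun U => ?_
  refine ⟨Finset.univ.filter fun b => IsEpsSolution (f b) X ε (U [] 0), ?_, fun b hb s hs k => ?_⟩
  · have hcard : (Finset.univ.filter fun b => IsEpsSolution (f b) X ε (U [] 0)).card ≤ 1 := by
      rw [Finset.card_le_one]
      have hsol : ∀ b, IsEpsSolution (f b) X ε (U [] 0) → |(U [] 0 : PiLp p fun _ : Fin d => ℝ) j₀ - σ b| < 1 := by
        intro b hb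
        have h1 := hb.2 _ (heX b)
        rw [hfe] at h1
        simp only [f] at h1
        linarith
      intro b hb b' hb'
      have h1 := abs_lt.1 (hsol b (Finset.mem_filter.1 hb).2)
      have h2 := abs_lt.1 (hsol b' (Finset.mem_filter.1 hb').2)
      cases b <;> cases b' <;> simp only [σ, if_true, Bool.false_eq_true, if_false] at h1 h2 ⊢ <;>
        linarith
    have h1 : ((Finset.univ.filter fun b => IsEpsSolution (f b) X ε (U [] 0)).card : ℝ) ≤ 1 := by
      exact_mod_cast hcard
    rw [Fintype.card_bool]
    push_cast
    linarith
  · obtain rfl : s = 0 := by omega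
    obtain rfl : k = 0 := Subsingleton.elim _ _
    simpa [transcript] using hb

end Complexity

/-! ### The implicit equation for the number of rounds -/

section RoundBound

variable {d K : ℕ} {p ε γ M : ℝ}

theorem le_roundBound_iff (hd : 0 < d) (hε : 0 < ε) (hM : 0 < M) :
    ENNReal.ofReal M ≤ roundBound d K p ε γ M ↔ M ≤ 1 / (200 * ε ^ 2) ∧
      M * (32 * √(Real.log (M * K / γ))) ≤ ε * (d : ℝ) ^ (1 / p.conjExponent) := by
  have hd0 : (0 : ℝ) < d := by exact_mod_cast hd
  have hc : 0 < ε * (d : ℝ) ^ (1 / p.conjExponent) := by positivity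
  rw [roundBound, le_min_iff, ENNReal.ofReal_le_ofReal_iff (by positivity),
    ENNReal.le_div_iff_mul_le (Or.inr (ENNReal.ofReal_pos.2 hc).ne') (Or.inl ENNReal.ofReal_ne_top),
    ← ENNReal.ofReal_mul hM.le, ENNReal.ofReal_le_ofReal_iff hc.le]

theorem roundBound_le_iff (hM : 0 < M) :
    roundBound d K p ε γ M ≤ ENNReal.ofReal M ↔ 1 / (200 * ε ^ 2) ≤ M ∨
      ε * (d : ℝ) ^ (1 / p.conjExponent) ≤ M * (32 * √(Real.log (M * K / γ))) := by
  rw [roundBound, min_le_iff, ENNReal.ofReal_le_ofReal_iff hM.le,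
    ENNReal.div_le_iff_le_mul (Or.inr ENNReal.ofReal_ne_top) (Or.inl ENNReal.ofReal_ne_top),
    ← ENNReal.ofReal_mul hM.le, ENNReal.ofReal_le_ofReal_iff (by positivity)]

/-- Existence and uniqueness hold because the product `M √(ln (M K / γ))` is continuous and, where it
is positive, strictly increasing in `M`. -/
theorem existsUnique_eq_roundBound (hd : 0 < d) (hK : 0 < K) (hε : 0 < ε) (hγ : 0 < γ) :
    ∃! M : ℝ, 0 < M ∧ ENNReal.ofReal M = roundBound d K p ε γ M := by
  have hd0 : (0 : ℝ) < d := by exact_mod_cast hd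
  have hK0 : (0 : ℝ) < K := by exact_mod_cast hK
  set a := 1 / (200 * ε ^ 2) with ha
  have ha0 : 0 < a := by positivity
  set c := ε * (d : ℝ) ^ (1 / p.conjExponent) with hc
  have hc0 : 0 < c := by positivity
  set h : ℝ → ℝ := fun M => M * (32 * √(Real.log (M * K / γ))) with hh
  have hiff : ∀ M, 0 < M → (ENNReal.ofReal M = roundBound d K p ε γ M ↔
      (M ≤ a ∧ h M ≤ c) ∧ (a ≤ M ∨ c ≤ h M)) := fun M hM => by
    rw [le_antisymm_iff, le_roundBound_iff hd hε hM, roundBound_le_iff hM]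
  have hmono : ∀ M M', 0 < M → M < M' → 0 < h M → h M < h M' := by
    intro M M' hM hMM' hpos
    have hle : √(Real.log (M * K / γ)) ≤ √(Real.log (M' * K / γ)) := by gcongr
    have hpos' : 0 < 32 * √(Real.log (M * K / γ)) := pos_of_mul_pos_right hpos hM.le
    calc h M < M' * (32 * √(Real.log (M * K / γ))) := mul_lt_mul_of_pos_right hMM' hpos'
      _ ≤ h M' := mul_le_mul_of_nonneg_left (by linarith) (hM.trans hMM').le
  have hex : ∃ M, 0 < M ∧ ENNReal.ofReal M = roundBound d K p ε γ M := by
    rcases le_or_gt (h a) c with hac | hac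
    · exact ⟨a, ha0, (hiff a ha0).2 ⟨⟨le_rfl, hac⟩, Or.inl le_rfl⟩⟩
    · have hm0 : 0 < γ / K := by positivity
      have hma : γ / K ≤ a := by
        by_contra! hlt
        have h1 : Real.log (a * K / γ) ≤ 0 := by
          refine Real.log_nonpos (by positivity) ?_
          rw [div_le_one hγ]
          exact ((lt_div_iff₀ hK0).1 hlt).le
        have h2 : h a = 0 := by simp only [hh, Real.sqrt_eq_zero_of_nonpos h1, mul_zero]
        linarith
      have hcont : ContinuousOn h (Set.Icc (γ / K) a) := by
        refine continuousOn_id.mul (continuousOn_const.mul (ContinuousOn.sqrt ?_))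
        refine ContinuousOn.log (by fun_prop) fun M hM => ?_
        have := hm0.trans_le hM.1
        positivity
      have hzero : h (γ / K) = 0 := by
        have : γ / K * K / γ = 1 := by field_simp
        simp only [hh, this, Real.log_one, Real.sqrt_zero, mul_zero]
      obtain ⟨M, hM, hMc⟩ := intermediate_value_Icc hma hcont
        (show c ∈ Set.Icc (h (γ / K)) (h a) from ⟨by rw [hzero]; exact hc0.le, hac.le⟩)
      exact ⟨M, hm0.trans_le hM.1, (hiff M (hm0.trans_le hM.1)).2 ⟨⟨hM.2, hMc.le⟩, Or.inr hMc.ge⟩⟩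
  have hlt : ∀ M M', 0 < M → ENNReal.ofReal M = roundBound d K p ε γ M →
      ENNReal.ofReal M' = roundBound d K p ε γ M' → ¬ M < M' := by
    intro M M' hM hMeq hMeq' hMM'
    obtain ⟨-, h1⟩ := (hiff M hM).1 hMeq
    obtain ⟨⟨h2, h3⟩, -⟩ := (hiff M' (hM.trans hMM')).1 hMeq'
    rcases h1 with h1 | h1
    · linarith
    · have := hmono M M' hM hMM' (hc0.trans_le h1)
      linarith
  obtain ⟨M, hM, hMeq⟩ := hex
  refine ⟨M, ⟨hM, hMeq⟩, fun M' hM' => ?_⟩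
  exact le_antisymm (not_lt.1 (hlt M M' hM hMeq hM'.2)) (not_lt.1 (hlt M' M hM'.1 hM'.2 hMeq))

/-- For large dimension, `1 / (200 ε²)` itself satisfies the inequality. -/
theorem le_roundBound_of_large_dim (hp : 1 < p) (hd : 0 < d) (hK : 0 < K) (hε : 0 < ε)
    (hε2 : ε < 1 / 2) (hγ : 0 < γ) (hγ1 : γ < 1)
    (h : (√(Real.log (K / (ε * γ))) / ε ^ 3) ^ p.conjExponent ≤ (d : ℝ)) :
    ENNReal.ofReal (1 / (200 * ε ^ 2)) ≤ roundBound d K p ε γ (1 / (200 * ε ^ 2)) := by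
  rw [le_roundBound_iff hd hε (by positivity)]
  refine ⟨le_rfl, ?_⟩
  have hK1 : (1 : ℝ) ≤ K := by exact_mod_cast hK
  have hq : 0 < p.conjExponent := (Real.HolderConjugate.conjExponent hp).symm.pos
  set S := √(Real.log (K / (ε * γ))) with hS
  have hS0 : 0 ≤ S := Real.sqrt_nonneg _
  have h1 : S / ε ^ 3 ≤ (d : ℝ) ^ (1 / p.conjExponent) := by
    have h2 := Real.rpow_le_rpow (by positivity) h (by positivity : 0 ≤ 1 / p.conjExponent)
    rwa [← Real.rpow_mul (by positivity), mul_one_div_cancel hq.ne', Real.rpow_one] at h2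
  have hlog : Real.log (1 / (200 * ε ^ 2) * K / γ) ≤ 4 * Real.log (K / (ε * γ)) := by
    have hge : 1 ≤ K / (ε * γ) := by
      rw [one_le_div (by positivity)]
      nlinarith
    have h3 : 1 / (200 * ε ^ 2) * K / γ ≤ (K / (ε * γ)) ^ 2 := by
      have e1 : 1 / (200 * ε ^ 2) * K / γ = K / (ε ^ 2 * γ ^ 2) * (γ / 200) := by field_simp
      have e2 : (K / (ε * γ)) ^ 2 = K / (ε ^ 2 * γ ^ 2) * K := by field_simp
      rw [e1, e2]
      gcongr
      linarith
    have h4 := Real.log_le_log (by positivity) h3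
    rw [Real.log_pow] at h4
    push_cast at h4
    linarith [Real.log_nonneg hge]
  have hsqrt : √(Real.log (1 / (200 * ε ^ 2) * K / γ)) ≤ 2 * S := by
    refine (Real.sqrt_le_sqrt hlog).trans_eq ?_
    rw [Real.sqrt_mul (by norm_num), show (4 : ℝ) = 2 ^ 2 by norm_num,
      Real.sqrt_sq (by norm_num)]
  calc _ ≤ 1 / (200 * ε ^ 2) * (32 * (2 * S)) := by gcongr
    _ = 64 / 200 * (S / ε ^ 2) := by ring
    _ ≤ S / ε ^ 2 := by
        have : 0 ≤ S / ε ^ 2 := by positivity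
        linarith
    _ = ε * (S / ε ^ 3) := by field_simp
    _ ≤ _ := by gcongr

end RoundBound

/-- With `u = 8 √(ln (M K / γ))` and `t = ε / (4 M)` the conditions of the union bound hold for every
`N < M`, provided `γ / (M K) ≤ 1/2`. -/
theorem succ_le_complHP_of_lt {d K : ℕ} {p : ℝ≥0∞} [Fact (1 ≤ p)]
    {X : Set (PiLp p (fun _ : Fin d => ℝ))} {𝓕 : Set (PiLp p (fun _ : Fin d => ℝ) → ℝ)}
    {A : Type*} {O : (PiLp p (fun _ : Fin d => ℝ) → ℝ) → PiLp p (fun _ : Fin d => ℝ) → A}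
    {ε γ M : ℝ} (hd : 0 < d) (hK : 0 < K) (hp : 1 ≤ p.toReal) (hp2 : p.toReal ≤ 2)
    (hXclosed : IsClosed X) (hX : Metric.closedBall 0 1 ⊆ X)
    (h𝓕 : 𝓕 = nonsmoothClass _ 1 ∨ 𝓕 = lipschitzClass X (1 / 2)) (hO : IsLocalOracle 𝓕 X O)
    (hε : 0 < ε) (hε2 : ε < 1 / 2) (hγ : 0 < γ) (hγ1 : γ < 1) {N : ℕ} (hN : 0 < N)
    (hNM : (N : ℝ) < M) (hM : M ≤ 1 / (200 * ε ^ 2))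
    (hMd : M * (32 * √(Real.log (M * K / γ))) ≤ ε * (d : ℝ) ^ (1 - 1 / p.toReal))
    (hhalf : γ / (M * K) ≤ 1 / 2) : ((N + 1 : ℕ) : ℕ∞) ≤ complHP 𝓕 X O K ε γ := by
  have hd1 : (1 : ℝ) ≤ d := by exact_mod_cast hd
  have hK1 : (1 : ℝ) ≤ K := by exact_mod_cast hK
  have hN1 : (1 : ℝ) ≤ N := by exact_mod_cast hN
  have hM0 : 0 < M := by linarith
  have hNK : (N : ℝ) * ε ^ 2 < 1 / 200 := by
    rw [le_div_iff₀ (by positivity)] at hM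
    nlinarith [pow_pos hε 2]
  set L := Real.log (M * K / γ) with hL
  have hL0 : 0 ≤ L := by
    refine Real.log_nonneg ?_
    rw [one_le_div hγ]
    rw [div_le_iff₀ (by positivity)] at hhalf
    nlinarith
  refine succ_le_complHP_of_union_bound (t := ε / (4 * M)) (u := 8 * √L) hd hK hp hp2 hXclosed hX
    h𝓕 hO hN (by positivity) (by positivity) ?_ ?_ ?_ ?_ ?_
  · rw [div_le_iff₀ (by positivity)]
    linarith
  · rw [div_mul_eq_mul_div, le_div_iff₀ (by positivity)]
    linarith
  · -- Since `1 / p* ≤ 1/2`, the bound on `M` gives `32 N √L ≤ √d`.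
    have h1 : (d : ℝ) ^ (1 - 1 / p.toReal) ≤ √d := by
      rw [Real.sqrt_eq_rpow]
      refine Real.rpow_le_rpow_of_exponent_le hd1 ?_
      have : 1 / 2 ≤ 1 / p.toReal := one_div_le_one_div_of_le (by linarith) hp2
      linarith
    have h2 : N * (32 * √L) ≤ √d := by
      have h3 : N * (32 * √L) ≤ M * (32 * √L) := by gcongr
      have h4 : ε * (d : ℝ) ^ (1 - 1 / p.toReal) ≤ 1 * √d := by gcongr; linarith
      linarith
    rw [le_div_iff₀ (by positivity)]
    calc 8 * √L * √d * (4 * N) = N * (32 * √L) * √d := by ring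
      _ ≤ √d * √d := by gcongr
      _ = d := Real.mul_self_sqrt (by linarith)
  · set w := γ / (M * K) with hw
    have hw0 : 0 < w := by positivity
    have hexp : Real.exp (-((8 * √L) ^ 2 / 2)) = w ^ 32 := by
      rw [mul_pow, Real.sq_sqrt hL0, hL, show w = Real.exp (-Real.log (M * K / γ)) by
        rw [Real.exp_neg, Real.exp_log (by positivity), inv_div], ← Real.exp_nat_mul]
      congr 1
      push_cast
      ring
    have hγw : γ = w * (M * K) := by rw [hw]; field_simp
    have hMw : M * w ≤ 1 := by
      have : M * w = γ / K := by rw [hw]; field_simp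
      rw [this, div_le_one (by linarith)]
      linarith
    have hw30 : w ^ 30 ≤ (1 / 2) ^ 30 := by gcongr
    rw [hexp]
    calc 4 * (N : ℝ) ^ 2 * K * w ^ 32 ≤ 4 * M ^ 2 * K * w ^ 32 := by gcongr
      _ = (M * w) * (4 * w ^ 30) * (w * (M * K)) := by ring
      _ ≤ 1 * (4 * (1 / 2) ^ 30) * (w * (M * K)) := by gcongr
      _ < γ := by rw [← hγw]; norm_num; linarith
  · have hs0 : 0 < √(N : ℝ) := Real.sqrt_pos.2 (by linarith)
    have h1 : 2 * (ε / (4 * M)) + N * (5 * (ε / (4 * M))) ≤ 7 / 4 * ε := by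
      have e : 2 * (ε / (4 * M)) + N * (5 * (ε / (4 * M))) = (2 + 5 * N) * ε / (4 * M) := by ring
      rw [e, div_le_iff₀ (by positivity)]
      nlinarith
    have h2 : (25 / 2 * ε) * √(N : ℝ) < 1 := by
      refine lt_of_pow_lt_pow_left₀ 2 zero_le_one ?_
      rw [mul_pow, Real.sq_sqrt (by linarith)]
      nlinarith
    rw [lt_div_iff₀ (by positivity)]
    calc _ ≤ (7 / 4 * ε + 2 * ε) * (10 * √(N : ℝ)) := by gcongr
      _ < 3 := by linarith

theorem theorem3 {d K : ℕ} (hd : 0 < d) (hK : 0 < K)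
    (p : ℝ≥0∞) [Fact (1 ≤ p)] (hp1 : 1 < p) (hp2 : p ≤ 2)
    (X : Set (PiLp p (fun _ : Fin d => ℝ))) (hXclosed : IsClosed X) (hXconvex : Convex ℝ X)
    (hX : Metric.closedBall (0 : PiLp p (fun _ : Fin d => ℝ)) 1 ⊆ X)
    (ε : ℝ) (hε : ε ∈ Set.Ioo (0 : ℝ) (1 / 2)) (γ : ℝ) (hγ : γ ∈ Set.Ioo (0 : ℝ) 1)
    (𝓕 : Set (PiLp p (fun _ : Fin d => ℝ) → ℝ))
    (h𝓕 : 𝓕 = nonsmoothClass (PiLp p (fun _ : Fin d => ℝ)) 1 ∨ 𝓕 = lipschitzClass X (1 / 2))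
    {A : Type*} (O : (PiLp p (fun _ : Fin d => ℝ) → ℝ) → PiLp p (fun _ : Fin d => ℝ) → A)
    (hO : IsLocalOracle 𝓕 X O) :
    (∃! M : ℝ, 0 < M ∧ ENNReal.ofReal M = roundBound d K p.toReal ε γ M) ∧
    (∀ M : ℝ, ENNReal.ofReal M ≤ roundBound d K p.toReal ε γ M →
      ENNReal.ofReal M ≤ (complHP 𝓕 X O K ε γ : ℝ≥0∞)) ∧
    ((Real.sqrt (Real.log (K / (ε * γ))) / ε ^ 3) ^ p.toReal.conjExponent ≤ (d : ℝ) →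
      ENNReal.ofReal (1 / (200 * ε ^ 2)) ≤ (complHP 𝓕 X O K ε γ : ℝ≥0∞)) := by
  obtain ⟨hε0, hε2⟩ := hε
  obtain ⟨hγ0, hγ1⟩ := hγ
  have hptop : p ≠ ⊤ := ne_top_of_le_ne_top (by simp) hp2
  have hp1' : 1 < p.toReal := by
    simpa using (ENNReal.toReal_lt_toReal (by simp) hptop).2 hp1
  have hp2' : p.toReal ≤ 2 := by simpa using ENNReal.toReal_mono (by simp) hp2
  have hbound : ∀ M : ℝ, ENNReal.ofReal M ≤ roundBound d K p.toReal ε γ M →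
      ENNReal.ofReal M ≤ (complHP 𝓕 X O K ε γ : ℝ≥0∞) := by
    intro M hM
    have hcast : ∀ n : ℕ, M ≤ n → (n : ℕ∞) ≤ complHP 𝓕 X O K ε γ →
        ENNReal.ofReal M ≤ (complHP 𝓕 X O K ε γ : ℝ≥0∞) := by
      intro n hMn hn
      have h1 := ENat.toENNReal_le.2 hn
      rw [ENat.toENNReal_coe] at h1
      exact (ENNReal.ofReal_le_of_le_toReal (by simpa using hMn)).trans h1
    rcases le_or_gt M 1 with hM1 | hM1
    · exact hcast 1 (by simpa using hM1)
        (by simpa using one_le_complHP hXclosed hX h𝓕 hγ0)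
    obtain ⟨hMε, hMd⟩ := (le_roundBound_iff hd hε0 (by linarith)).1 hM
    have hconj : 1 / p.toReal.conjExponent = 1 - 1 / p.toReal := by
      have := (Real.HolderConjugate.conjExponent hp1').inv_add_inv_eq_one
      simp only [one_div]
      linarith
    rw [hconj] at hMd
    have hceil : 1 < ⌈M⌉₊ := Nat.lt_ceil.2 (by simpa using hM1)
    obtain ⟨N, hN⟩ : ∃ N, ⌈M⌉₊ = N + 1 := ⟨⌈M⌉₊ - 1, by omega⟩
    have hNM : (N : ℝ) < M := Nat.lt_ceil.1 (by omega)
    have hMN : M ≤ (N + 1 : ℕ) := hN ▸ Nat.le_ceil M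
    have hK1 : (1 : ℝ) ≤ K := by exact_mod_cast hK
    rcases le_or_gt (γ / (M * K)) (1 / 2) with hhalf | hhalf
    · exact hcast (N + 1) hMN (succ_le_complHP_of_lt hd hK hp1'.le hp2' hXclosed hX h𝓕 hO hε0 hε2
        hγ0 hγ1 (by omega) hNM hMε hMd hhalf)
    · -- Now `M K < 2 γ < 2`, which forces `K = 1`, `M < 2` and `γ > 1/2`.
      rw [lt_div_iff₀ (by positivity)] at hhalf
      have hM2 : M ≤ (2 : ℕ) := by push_cast; nlinarith
      have hK2 : (K : ℝ) < 2 := by nlinarith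
      obtain rfl : K = 1 := by
        have : K < 2 := by exact_mod_cast hK2
        omega
      exact hcast 2 hM2 (two_le_complHP hd hX h𝓕 hε2 (by push_cast at hhalf; linarith))
  exact ⟨existsUnique_eq_roundBound hd hK hε0 hγ0, hbound, fun h =>
    hbound _ (le_roundBound_of_large_dim hp1' hd hK hε0 hε2 hγ0 hγ1 h)⟩
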